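/- All graphs are finite, undirected and simple. For $k\ge 0$ let $\mathcal{D}_k$ be the class of graphs $G$ such that every minor of $G$ has minimum degree at most $k$, and let $\widehat{\mathcal{D}}_k$ be the set of its minimal forbidden minors, that is, the graphs $G\notin\mathcal{D}_k$ such that every proper minor of $G$ is in $\mathcal{D}_k$. The block decomposition tree of a connected graph $G$ has as its vertices the blocks of $G$ (cut-edges and maximal $2$-connected subgraphs) and the cut-vertices of $G$, a block $b$ being adjacent to a cut-vertex $c$ whenever $b$ contains $c$. A low-high tree is a tree $T$ that admits a bipartition $V(T)=V_\ell\cup V_h$ (every edge having one end in $V_\ell$ and the other in $V_h$) such that every vertex in $V_\ell$ has degree at most $2$ and every vertex in $V_h$ has degree at least $2$. Theorem. For every low-high tree $T$ with at least one edge there are an integer $d$ and a connected graph $G$ such that (G1) $G$ is $d$-regular; (G2) $T$ is (isomorphic to) the block decomposition tree of $G$; (G3) $8\le d\le 4|E(T)|$; and (G4) $G\in\widehat{\mathcal{D}}_{d-1}$. -/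

import Mathlib

namespace SimpleGraph

/-! ### Minors and minimal forbidden minors -/

/-- `H` is a minor of `G`: there are pairwise disjoint branch sets, each non-empty and inducing a
connected subgraph of `G`, indexed by the vertices of `H`, such that adjacent vertices of `H` have
branch sets joined by an edge of `G`. Equivalently, a graph isomorphic to `H` is obtained from a
subgraph of `G` by contracting edges. -/
def IsMinor {W V : Type*} (H : SimpleGraph W) (G : SimpleGraph V) : Prop :=
  ∃ B : W → Set V,
    (∀ w, (G.induce (B w)).Connected) ∧
    (∀ a b, a ≠ b → Disjoint (B a) (B b)) ∧
    (∀ a b, H.Adj a b → ∃ x ∈ B a, ∃ y ∈ B b, G.Adj x y)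

/-- A minor of `G` that is not isomorphic to `G` (for finite graphs: a minor other than `G`
itself). -/
def IsProperMinor {W V : Type*} (H : SimpleGraph W) (G : SimpleGraph V) : Prop :=
  H.IsMinor G ∧ ¬ Nonempty (H ≃g G)

/-- `G` is a minimal forbidden minor of the class `X`: `G` is not in `X`, but every proper minor
of `G` is in `X`. -/
def IsMinimalForbiddenMinor (X : ∀ V : Type, SimpleGraph V → Prop)
    {V : Type} (G : SimpleGraph V) : Prop :=
  ¬ X V G ∧ ∀ (W : Type) [Finite W] (H : SimpleGraph W), H.IsProperMinor G → X W H

/-- The class `𝒟_k` of graphs for which every minor has minimum degree at most `k`. -/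
def MinorMinDegreeLE (k : ℕ) (V : Type) (G : SimpleGraph V) : Prop :=
  ∀ (W : Type) [Fintype W] (H : SimpleGraph W) [DecidableRel H.Adj],
    H.IsMinor G → H.minDegree ≤ k

/-! ### Blocks, cut-vertices and the block decomposition tree -/

/-- The vertex set `S` has at least three elements, and the subgraph induced by `S` is connected
and remains connected when any one vertex is deleted. -/
def IsTwoConnectedOn {V : Type*} (G : SimpleGraph V) (S : Set V) : Prop :=
  3 ≤ S.encard ∧ (G.induce S).Connected ∧ ∀ v ∈ S, (G.induce (S \ {v})).Connected

/-- `S` is the vertex set of a block of `G`, that is, of a cut-edge or of a maximal 2-connected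
subgraph. Blocks are induced subgraphs, so a block is identified with its vertex set. -/
def IsBlock {V : Type*} (G : SimpleGraph V) (S : Set V) : Prop :=
  (∃ u v, G.Adj u v ∧ G.IsBridge s(u, v) ∧ S = {u, v}) ∨ Maximal G.IsTwoConnectedOn S

/-- Deleting `c` disconnects two vertices, other than `c`, that are connected in `G`. -/
def IsCutVertex {V : Type*} (G : SimpleGraph V) (c : V) : Prop :=
  ∃ (u w : V) (hu : u ∈ ({c}ᶜ : Set V)) (hw : w ∈ ({c}ᶜ : Set V)),
    G.Reachable u w ∧ ¬ (G.induce {c}ᶜ).Reachable ⟨u, hu⟩ ⟨w, hw⟩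

/-- The graph whose vertices are the blocks and the cut-vertices of `G`, where a block `b` and a
cut-vertex `c` are adjacent whenever `b` contains `c`. -/
def blockGraph {V : Type*} (G : SimpleGraph V) :
    SimpleGraph ({S : Set V // G.IsBlock S} ⊕ {c : V // G.IsCutVertex c}) :=
  SimpleGraph.fromRel fun x y =>
    ∃ (b : {S : Set V // G.IsBlock S}) (c : {c : V // G.IsCutVertex c}),
      x = Sum.inl b ∧ y = Sum.inr c ∧ c.1 ∈ b.1

/-- `T` is (isomorphic to) the block decomposition tree of the connected graph `G`. -/
def IsBlockDecompositionTreeOf {U V : Type*} (T : SimpleGraph U) (G : SimpleGraph V) : Prop :=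
  G.Connected ∧ Nonempty (T ≃g G.blockGraph)

/-! ### Low-high trees -/

/-- A tree with a bipartition into a set `Vl` of low vertices, all of degree at most `2`, and a set
`Vh` of high vertices, all of degree at least `2`. -/
def IsLowHighTree {U : Type*} [Fintype U] (T : SimpleGraph U) [DecidableRel T.Adj] : Prop :=
  T.IsTree ∧ ∃ Vl Vh : Set U,
    Vl ∪ Vh = Set.univ ∧ T.IsBipartiteWith Vl Vh ∧
    (∀ v ∈ Vl, T.degree v ≤ 2) ∧ (∀ v ∈ Vh, 2 ≤ T.degree v)

end SimpleGraph

/-!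
Each low vertex of `T` is regarded as an edge of an auxiliary tree, dangling if the vertex has
degree one, so that `T` arises from the auxiliary tree by subdividing all edges and deleting the
leaves. With `L` the set of edges of the auxiliary tree, every edge `b` is replaced by a block
with `4 |L|` new vertices `(b, b₁, i)`, each adjacent to all but one of the other vertices of the
block. An end of `b` is joined to `(b, b₁, i)` precisely when `b₁` lies in the branch that starts
at this end with `b`. The branches at a vertex of the auxiliary tree partition `L`, so the
resulting graph is `4 |L|`-regular, and its blocks and cut-vertices form the tree `T`.

Consider a minor with all degrees at least `4 |L|`. If a branch set lies in the interior of a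
block, then at least `4 |L| + 1` branch sets meet this block of `4 |L| + 2` vertices, so at most
one vertex is lost to a contraction or a deletion. If one were, then some non-adjacent pair of the
block would survive, and its vertices would have too few neighbours in the minor; hence every
vertex of the block lies in a branch set of its own, and the block is preserved. A branch set that
contains a vertex of the auxiliary tree reaches each of its neighbours in the minor through a slot
`(b₁, i)`, where `b₁` lies in the branch entered. These branches are disjoint, so different
neighbours use different slots, and all `4 |L|` slots are used. A block that is not preserved
could fill only one of the four slots with its own index, so every block with an end in the branch
set is preserved. By connectedness all blocks are preserved, and the minor has as many vertices as
the graph.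
-/

section Minors

open SimpleGraph Set

variable {U V W : Type*} {F : SimpleGraph U} {H : SimpleGraph W} {G : SimpleGraph V}

lemma reachable_induce_of_subset {S S' : Set V} (hS : (G.induce S).Connected) (h : S ⊆ S')
    {x y : V} (hx : x ∈ S) (hy : y ∈ S) : (G.induce S').Reachable ⟨x, h hx⟩ ⟨y, h hy⟩ :=
  (hS.preconnected ⟨x, hx⟩ ⟨y, hy⟩).map (G.induceHomOfLE h).toHom

/-- The sets `B w` are the branch sets of a model of `H` as a minor of `G`. -/
structure IsMinorModel (H : SimpleGraph W) (G : SimpleGraph V) (B : W → Set V) : Prop where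
  connected (w : W) : (G.induce (B w)).Connected
  pairwise_disjoint : Pairwise (Function.onFun Disjoint B)
  exists_adj {w w' : W} (h : H.Adj w w') : ∃ x ∈ B w, ∃ y ∈ B w', G.Adj x y

lemma isMinor_iff_exists_isMinorModel : H.IsMinor G ↔ ∃ B, IsMinorModel H G B :=
  ⟨fun ⟨B, hconn, hdisj, hadj⟩ ↦ ⟨B, hconn, fun _ _ ↦ hdisj _ _, hadj _ _⟩,
    fun ⟨B, hB⟩ ↦ ⟨B, hB.connected, fun _ _ ↦ (hB.pairwise_disjoint ·), fun _ _ ↦ hB.exists_adj⟩⟩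

namespace IsMinorModel

variable {A : U → Set W} {B : W → Set V}

lemma nonempty (hB : IsMinorModel H G B) (w : W) : (B w).Nonempty :=
  nonempty_coe_sort.1 (hB.connected w).nonempty

lemma eq_of_mem (hB : IsMinorModel H G B) {w w' : W} {x : V} (hx : x ∈ B w) (hx' : x ∈ B w') :
    w = w' :=
  hB.pairwise_disjoint.eq (not_disjoint_iff.2 ⟨x, hx, hx'⟩)

lemma connected_biUnion (hB : IsMinorModel H G B) {S : Set W} (hS : (H.induce S).Connected) :
    (G.induce (⋃ w ∈ S, B w)).Connected := by
  have hsub (w : S) : B w ⊆ ⋃ w ∈ S, B w := subset_biUnion_of_mem w.2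
  have reach {w w' : S} (p : (H.induce S).Walk w w') :
      ∀ x y, ∀ (hx : x ∈ B w) (hy : y ∈ B w'),
        (G.induce (⋃ w ∈ S, B w)).Reachable ⟨x, hsub w hx⟩ ⟨y, hsub w' hy⟩ := by
    induction p with
    | nil => exact fun _ _ hx hy ↦ reachable_induce_of_subset (hB.connected _) (hsub _) hx hy
    | cons hadj _ ih =>
      intro x y hx hy
      obtain ⟨a, ha, b, hb, hab⟩ := hB.exists_adj hadj
      have hxa := reachable_induce_of_subset (hB.connected _) (hsub _) hx ha
      exact (hxa.trans (Adj.reachable (by exact hab))).trans (ih b y hb hy)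
  obtain ⟨w₀⟩ := hS.nonempty
  obtain ⟨x₀, hx₀⟩ := hB.nonempty w₀
  refine (connected_iff _).2 ⟨?_, ⟨x₀, hsub w₀ hx₀⟩⟩
  rintro ⟨x, hx⟩ ⟨y, hy⟩
  obtain ⟨w, hw, hxw⟩ := mem_iUnion₂.1 hx
  obtain ⟨w', hw', hyw'⟩ := mem_iUnion₂.1 hy
  obtain ⟨p⟩ := hS.preconnected ⟨w, hw⟩ ⟨w', hw'⟩
  exact reach p x y hxw hyw'

lemma comp (hA : IsMinorModel F H A) (hB : IsMinorModel H G B) :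
    IsMinorModel F G fun u ↦ ⋃ w ∈ A u, B w where
  connected u := hB.connected_biUnion (hA.connected u)
  pairwise_disjoint u u' huu' := by
    simp only [Function.onFun, disjoint_iUnion_left, disjoint_iUnion_right]
    exact fun w' hw' w hw ↦ hB.pairwise_disjoint fun h ↦ huu' (hA.eq_of_mem hw (h ▸ hw'))
  exists_adj h := by
    obtain ⟨w, hw, w', hw', hadj⟩ := hA.exists_adj h
    obtain ⟨x, hx, y, hy, hxy⟩ := hB.exists_adj hadj
    exact ⟨x, mem_biUnion hw hx, y, mem_biUnion hw' hy, hxy⟩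

lemma exists_injective_representatives (hB : IsMinorModel H G B) :
    ∃ r : W → V, Function.Injective r ∧ ∀ w, r w ∈ B w := by
  choose r hr using hB.nonempty
  exact ⟨r, fun w w' h ↦ hB.eq_of_mem (hr w) (h ▸ hr w'), hr⟩

lemma card_le [Finite V] (hB : IsMinorModel H G B) : Nat.card W ≤ Nat.card V :=
  let ⟨_, hr, _⟩ := hB.exists_injective_representatives
  Nat.card_le_card_of_injective _ hr

lemma exists_bijective_hom_of_card_le [Finite V] (hB : IsMinorModel H G B)
    (hcard : Nat.card V ≤ Nat.card W) : ∃ f : H →g G, Function.Bijective f := by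
  obtain ⟨r, hinj, hr⟩ := hB.exists_injective_representatives
  have hbij : Function.Bijective r := hinj.bijective_of_nat_card_le hcard
  have eq_r {w : W} {x : V} (hx : x ∈ B w) : x = r w := by
    obtain ⟨w', rfl⟩ := hbij.surjective x
    rw [hB.eq_of_mem hx (hr w')]
  refine ⟨⟨r, fun {w w'} h ↦ ?_⟩, hbij⟩
  obtain ⟨x, hx, y, hy, hxy⟩ := hB.exists_adj h
  rwa [← eq_r hx, ← eq_r hy]

end IsMinorModel

lemma isMinor_of_iso (f : H ≃g G) : H.IsMinor G :=
  isMinor_iff_exists_isMinorModel.2 ⟨fun w ↦ {f w},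
    { connected := fun _ ↦ connected_top.mono (by simp)
      pairwise_disjoint := fun _ _ h ↦ disjoint_singleton.2 (f.injective.ne h)
      exists_adj := fun h ↦ ⟨_, rfl, _, rfl, f.map_adj_iff.2 h⟩ }⟩

lemma isMinor_trans (hFH : F.IsMinor H) (hHG : H.IsMinor G) : F.IsMinor G := by
  obtain ⟨A, hA⟩ := isMinor_iff_exists_isMinorModel.1 hFH
  obtain ⟨B, hB⟩ := isMinor_iff_exists_isMinorModel.1 hHG
  exact isMinor_iff_exists_isMinorModel.2 ⟨_, hA.comp hB⟩

lemma ncard_neighborSet_le_of_injective_hom [Finite V] {f : H →g G} (hf : Function.Injective f)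
    (w : W) : (H.neighborSet w).ncard ≤ (G.neighborSet (f w)).ncard :=
  ncard_le_ncard_of_injOn f (fun _ h ↦ f.map_adj h) hf.injOn

lemma nonempty_iso_of_bijective_hom [Finite V] {f : H →g G} (hf : Function.Bijective f)
    (hdeg : ∀ w, (G.neighborSet (f w)).ncard ≤ (H.neighborSet w).ncard) : Nonempty (H ≃g G) := by
  have image_neighborSet (w : W) : f '' H.neighborSet w = G.neighborSet (f w) :=
    eq_of_subset_of_ncard_le (image_subset_iff.2 fun _ h ↦ f.map_adj h)
      ((hdeg w).trans_eq (ncard_image_of_injective _ hf.injective).symm)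
  refine ⟨⟨Equiv.ofBijective f hf, fun {w w'} ↦ ?_⟩⟩
  calc G.Adj (f w) (f w') ↔ f w' ∈ f '' H.neighborSet w := by
        rw [image_neighborSet, mem_neighborSet]
    _ ↔ H.Adj w w' := hf.injective.mem_set_image

lemma isMinimalForbiddenMinor_of_regular {V : Type} [Finite V] [Nonempty V] {G : SimpleGraph V}
    {d : ℕ} (hd : 0 < d) (hreg : ∀ v, (G.neighborSet v).ncard = d)
    (hcard : ∀ (W : Type) [Finite W] [Nonempty W] (K : SimpleGraph W), K.IsMinor G →
      (∀ w, d ≤ (K.neighborSet w).ncard) → Nat.card V ≤ Nat.card W) :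
    G.IsMinimalForbiddenMinor (MinorMinDegreeLE (d - 1)) := by
  classical
  have degree_eq {W : Type} [Fintype W] (K : SimpleGraph W) [DecidableRel K.Adj] (w : W) :
      (K.neighborSet w).ncard = K.degree w := by
    rw [← Nat.card_coe_set_eq, Nat.card_eq_fintype_card, card_neighborSet_eq_degree]
  constructor
  · have := Fintype.ofFinite V
    intro hG
    obtain ⟨v, hv⟩ := G.exists_minimal_degree_vertex
    have := hG V G (isMinor_of_iso .refl)
    rw [hv, ← degree_eq, hreg] at this
    omega
  · intro W _ H ⟨hHG, hproper⟩ X _ K _ hKH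
    by_contra! hK
    have hdegK (x : X) : d ≤ (K.neighborSet x).ncard := by
      have := K.minDegree_le_degree x
      rw [degree_eq]
      omega
    have : Nonempty X := not_isEmpty_iff.1 fun _ ↦ by simp at hK
    have hVX := hcard X K (isMinor_trans hKH hHG) hdegK
    obtain ⟨A, hA⟩ := isMinor_iff_exists_isMinorModel.1 hKH
    obtain ⟨B, hB⟩ := isMinor_iff_exists_isMinorModel.1 hHG
    obtain ⟨f, hf⟩ := hA.exists_bijective_hom_of_card_le (hB.card_le.trans hVX)
    obtain ⟨g, hg⟩ := hB.exists_bijective_hom_of_card_le (hVX.trans hA.card_le)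
    refine hproper (nonempty_iso_of_bijective_hom hg fun w ↦ ?_)
    obtain ⟨x, rfl⟩ := hf.surjective w
    rw [hreg]
    exact (hdegK x).trans (ncard_neighborSet_le_of_injective_hom hf.injective x)

end Minors

section Preserved

open SimpleGraph Set

variable {V W : Type*} {B : W → Set V} {S : Set V}

/-- Each vertex of `S` is the only vertex of `S` in some set of the family `B`: when the sets of
`B` are contracted and the uncovered vertices are deleted, `S` survives vertex by vertex. -/
def IsPreserved (B : W → Set V) (S : Set V) : Prop :=
  ∀ x ∈ S, ∃ w, B w ∩ S = {x}

lemma ncard_eq_and_exists_pair_of_not_isPreserved (hB : Pairwise (Function.onFun Disjoint B))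
    (hS : S.Finite) (hcard : S.ncard ≤ {w | (B w ∩ S).Nonempty}.ncard + 1)
    (hpres : ¬ IsPreserved B S) :
    S.ncard = {w | (B w ∩ S).Nonempty}.ncard + 1 ∧
      ∃ u z, ∀ x ∈ S, x ≠ u → x ≠ z → ∃ w, B w ∩ S = {x} := by
  obtain ⟨u, huS, hu⟩ : ∃ u ∈ S, ∀ w, B w ∩ S ≠ {u} := by
    simpa only [IsPreserved, not_forall, not_exists, exists_prop] using hpres
  set N := {w | (B w ∩ S).Nonempty}
  have exists_ne (w : N) : ∃ x ∈ B w ∩ S, x ≠ u := by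
    by_contra! h
    exact hu w (w.2.subset_singleton_iff.1 h)
  choose r hr hru using exists_ne
  have hinj : Function.Injective r := fun w w' h ↦
    Subtype.ext (hB.eq (not_disjoint_iff.2 ⟨r w, (hr w).1, h ▸ (hr w').1⟩))
  have hdiff : (S \ {u}).ncard + 1 = S.ncard := ncard_sdiff_singleton_add_one huS hS
  have hrange : (range r).ncard = N.ncard := by
    rw [ncard_range_of_injective hinj, Nat.card_coe_set_eq]
  have hsub : range r ⊆ S \ {u} := range_subset_iff.2 fun w ↦ ⟨(hr w).2, hru w⟩
  have range_eq : range r = S \ {u} :=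
    eq_of_subset_of_ncard_le hsub (by omega) (hS.subset sdiff_subset)
  refine ⟨by rw [← hdiff, ← range_eq, hrange], u, ?_⟩
  have inter_eq (w : N) (h : u ∉ B w) : B w ∩ S = {r w} := by
    refine (singleton_subset_iff.2 (hr w)).antisymm' fun y hy ↦ ?_
    obtain ⟨w', rfl⟩ : y ∈ range r := range_eq ▸ ⟨hy.2, fun hyu ↦ h (hyu ▸ hy.1)⟩
    rw [Subtype.ext (hB.eq (not_disjoint_iff.2 ⟨_, hy.1, (hr w').1⟩))]; rfl
  by_cases hcov : ∃ w : N, u ∈ B w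
  · obtain ⟨w₀, hw₀⟩ := hcov
    refine ⟨r w₀, fun x hx hxu hxw₀ ↦ ?_⟩
    obtain ⟨w, rfl⟩ : x ∈ range r := range_eq ▸ ⟨hx, hxu⟩
    refine ⟨w, inter_eq w fun h ↦ hxw₀ ?_⟩
    rw [Subtype.ext (hB.eq (not_disjoint_iff.2 ⟨u, h, hw₀⟩))]
  · refine ⟨u, fun x hx hxu _ ↦ ?_⟩
    obtain ⟨w, rfl⟩ : x ∈ range r := range_eq ▸ ⟨hx, hxu⟩
    exact ⟨w, inter_eq w fun h ↦ hcov ⟨w, h⟩⟩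

variable {H : SimpleGraph W} {G : SimpleGraph V}

lemma IsMinorModel.subsingleton_of_isPreserved (hB : IsMinorModel H G B)
    (hpres : ∀ ⦃x y⦄, G.Adj x y → ∃ S, x ∈ S ∧ y ∈ S ∧ IsPreserved B S) (w : W) :
    (B w).Subsingleton := by
  by_contra! hw
  have : Nontrivial (B w) := hw.coe_sort
  obtain ⟨x, hx⟩ := hB.nonempty w
  obtain ⟨⟨y, hy⟩, hxy : G.Adj x y⟩ :=
    (hB.connected w).preconnected.exists_adj_of_nontrivial ⟨x, hx⟩
  obtain ⟨S, hxS, hyS, hS⟩ := hpres hxy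
  obtain ⟨w', hw'⟩ := hS x hxS
  have hxw' : x ∈ B w' ∩ S := hw'.symm ▸ mem_singleton x
  have hyx : y ∈ B w' ∩ S := ⟨hB.eq_of_mem hx hxw'.1 ▸ hy, hyS⟩
  rw [hw'] at hyx
  exact hxy.ne hyx.symm

lemma card_le_card_of_subsingleton [Finite W] (hB : ∀ w, (B w).Subsingleton)
    (hcover : ∀ x, ∃ w, x ∈ B w) : Nat.card V ≤ Nat.card W := by
  choose f hf using hcover
  exact Nat.card_le_card_of_injective f fun x y h ↦ hB (f y) (h ▸ hf x) (hf y)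

end Preserved

section Connectivity

open SimpleGraph Set

variable {V : Type*} {G : SimpleGraph V} {R S : Set V} {a b c : V}

lemma mem_inter_of_reachable_induce (hR : ∀ ⦃x y⦄, x ∈ R → y ∉ R → G.Adj x y → x = c) {x y : S}
    (hxy : (G.induce S).Reachable x y) (hx : x.1 ∈ R) (hy : y.1 ∉ R) : c ∈ S ∩ R := by
  obtain ⟨p⟩ := hxy
  obtain ⟨d, -, hfst, hsnd⟩ := p.exists_boundary_dart (Subtype.val ⁻¹' R) hx hy
  exact hR hfst hsnd d.adj ▸ ⟨d.fst.2, hfst⟩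

lemma subset_or_inter_subset_of_isTwoConnectedOn
    (hR : ∀ ⦃x y⦄, x ∈ R → y ∉ R → G.Adj x y → x = c) (hS : G.IsTwoConnectedOn S) :
    S ⊆ R ∨ S ∩ R ⊆ {c} := by
  by_contra! h
  obtain ⟨y, hyS, hyR⟩ := not_subset.1 h.1
  obtain ⟨x, ⟨hxS, hxR⟩, hxc : x ≠ c⟩ := not_subset.1 h.2
  have hc : c ∈ S ∩ R :=
    mem_inter_of_reachable_induce hR (hS.2.1.preconnected ⟨x, hxS⟩ ⟨y, hyS⟩) hxR hyR
  have hyc : y ≠ c := fun h ↦ hyR (h ▸ hc.2)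
  have hc' : c ∈ (S \ {c}) ∩ R := mem_inter_of_reachable_induce hR
    ((hS.2.2 c hc.1).preconnected ⟨x, hxS, hxc⟩ ⟨y, hyS, hyc⟩) hxR hyR
  exact hc'.1.2 rfl

lemma connected_of_dominating_adj (hab : G.Adj a b) (hdom : ∀ x, G.Adj x a ∨ G.Adj x b) :
    G.Connected := by
  have reach (x : V) : G.Reachable x a := (hdom x).elim (·.reachable)
    (·.reachable.trans hab.symm.reachable)
  exact (connected_iff _).2 ⟨fun x y ↦ (reach x).trans (reach y).symm, ⟨a⟩⟩

lemma connected_induce_of_dominating_adj (ha : a ∈ S) (hb : b ∈ S) (hab : G.Adj a b)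
    (hdom : ∀ x ∈ S, G.Adj x a ∨ G.Adj x b) : (G.induce S).Connected :=
  connected_of_dominating_adj (a := ⟨a, ha⟩) (b := ⟨b, hb⟩) hab fun x ↦ hdom x x.2

lemma isTwoConnectedOn_of_dominating_edges {a' b' : V} (hsub : {a, b, a', b'} ⊆ S)
    (hab : G.Adj a b) (hab' : G.Adj a' b') (hdisj : Disjoint {a, b} ({a', b'} : Set V))
    (hdom : ∀ x ∈ S, G.Adj x a ∨ G.Adj x b) (hdom' : ∀ x ∈ S, G.Adj x a' ∨ G.Adj x b') :
    G.IsTwoConnectedOn S := by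
  simp only [insert_subset_iff, singleton_subset_iff] at hsub
  obtain ⟨ha, hb, ha', hb'⟩ := hsub
  simp only [disjoint_insert_left, disjoint_singleton_left, mem_insert_iff, mem_singleton_iff,
    not_or] at hdisj
  obtain ⟨⟨haa', hab''⟩, hba', hbb'⟩ := hdisj
  refine ⟨?_, connected_induce_of_dominating_adj ha hb hab hdom, fun v _ ↦ ?_⟩
  · rw [← encard_eq_three.2 ⟨a, b, a', hab.ne, haa', hba', rfl⟩]
    exact encard_le_encard (insert_subset ha (pair_subset hb ha'))
  · by_cases hv : v = a ∨ v = b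
    · exact connected_induce_of_dominating_adj ⟨ha', by grind⟩ ⟨hb', by grind⟩ hab'
        fun x hx ↦ hdom' x hx.1
    · exact connected_induce_of_dominating_adj ⟨ha, by grind⟩ ⟨hb, by grind⟩ hab
        fun x hx ↦ hdom x hx.1

lemma not_isBridge_of_isTwoConnectedOn (hS : G.IsTwoConnectedOn S) (ha : a ∈ S) (hb : b ∈ S)
    (hab : a ≠ b) : ¬ G.IsBridge s(a, b) := by
  have reach {v : V} (hv : v ∈ S) (hvab : v = a ∨ v = b) {x y : V} (hx : x ∈ S \ {v})
      (hy : y ∈ S \ {v}) : (G.deleteEdges {s(a, b)}).Reachable x y := by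
    let f : G.induce (S \ {v}) →g G.deleteEdges {s(a, b)} :=
      ⟨Subtype.val, fun {x y} hxy ↦ deleteEdges_adj.2 ⟨hxy, fun h ↦ by
        have := x.2.2
        have := y.2.2
        grind⟩⟩
    exact ((hS.2.2 v hv).preconnected ⟨x, hx⟩ ⟨y, hy⟩).map f
  obtain ⟨c, hc, hca, hcb⟩ : ∃ c ∈ S, c ≠ a ∧ c ≠ b := by
    by_contra! h
    have hle : S.encard ≤ ({a, b} : Set V).encard := encard_le_encard fun x hx ↦ by
      by_cases hxa : x = a
      · exact .inl hxa
      · exact .inr (h x hx hxa)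
    have := hS.1.trans (hle.trans_eq (encard_pair hab))
    norm_num at this
  exact fun h ↦ h ((reach hb (.inr rfl) ⟨ha, hab⟩ ⟨hc, hcb⟩).trans
    (reach ha (.inl rfl) ⟨hc, hca⟩ ⟨hb, hab.symm⟩))

lemma isBlock_iff_mem_range {ι : Type*} {block : ι → Set V}
    (htwo : ∀ i, G.IsTwoConnectedOn (block i))
    (hcover : ∀ ⦃x y⦄, G.Adj x y → ∃ i, x ∈ block i ∧ y ∈ block i)
    (hmax : ∀ ⦃S⦄, G.IsTwoConnectedOn S → ∃ i, S ⊆ block i)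
    (hanti : ∀ ⦃i j⦄, block i ⊆ block j → i = j) : G.IsBlock S ↔ S ∈ range block := by
  constructor
  · rintro (⟨u, v, huv, hbridge, -⟩ | hS)
    · obtain ⟨i, hu, hv⟩ := hcover huv
      exact absurd hbridge (not_isBridge_of_isTwoConnectedOn (htwo i) hu hv huv.ne)
    · obtain ⟨i, hi⟩ := hmax hS.prop
      exact ⟨i, (hS.eq_of_subset (htwo i) hi).symm⟩
  · rintro ⟨i, rfl⟩
    refine .inr ⟨htwo i, fun S hS hiS ↦ ?_⟩
    obtain ⟨j, hj⟩ := hmax hS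
    obtain rfl := hanti (hiS.trans hj)
    exact hj

end Connectivity

/-- A tree with edge set `L` and vertex set `C`: the edge `b` joins `endpoint b false` and
`endpoint b true`, deleting `b` splits the vertices into two sides, and `side b c = s` says that `c`
lies on the side of `endpoint b s`. Connectedness is encoded as an induction principle. -/
structure EdgeTree (L C : Type*) where
  endpoint : L → Bool → C
  side : L → C → Bool
  side_endpoint (b : L) (s : Bool) : side b (endpoint b s) = s
  side_endpoint_eq {b b' : L} (h : b' ≠ b) (s t : Bool) :
    side b (endpoint b' s) = side b (endpoint b' t)
  induction (P : C → Prop) (step : ∀ b s t, P (endpoint b s) → P (endpoint b t)) {c c' : C} :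
    P c → P c'

namespace EdgeTree

open SimpleGraph Set

variable {L C : Type*} (A : EdgeTree L C) {b b' b₁ : L} {c : C}

lemma endpoint_injective (b : L) : Function.Injective (A.endpoint b) := fun s t h ↦ by
  rw [← A.side_endpoint b s, h, A.side_endpoint]

/-- The side of `b` on which both ends of another edge `b₁` lie. -/
def toward (b b₁ : L) : Bool := A.side b (A.endpoint b₁ true)

lemma side_endpoint_of_ne (h : b' ≠ b) (s : Bool) : A.side b (A.endpoint b' s) = A.toward b b' :=
  A.side_endpoint_eq h s true

/-- The edges of the branch that leaves `endpoint b s` through `b`: the edge `b` itself and all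
edges beyond it. -/
def branch (b : L) (s : Bool) : Set L := {b₁ | b₁ = b ∨ A.toward b b₁ ≠ s}

lemma self_mem_branch (b : L) (s : Bool) : b ∈ A.branch b s := .inl rfl

lemma disjoint_branch (h : b ≠ b') :
    Disjoint (A.branch b (A.toward b b')) (A.branch b' (A.toward b' b)) := by
  rw [Set.disjoint_left]
  rintro b₁ (rfl | hb) (rfl | hb')
  · exact h rfl
  · exact hb' rfl
  · exact hb rfl
  · refine A.induction (c := A.endpoint b₁ true) (c' := A.endpoint b' true)
      (fun c ↦ A.side b c ≠ A.toward b b' ∧ A.side b' c ≠ A.toward b' b) ?_ ⟨hb, hb'⟩ |>.1 rfl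
    rintro f s t ⟨hf, hf'⟩
    by_cases hfb : f = b
    · exact absurd (by rw [hfb, A.side_endpoint_of_ne h]) hf'
    by_cases hfb' : f = b'
    · exact absurd (by rw [hfb', A.side_endpoint_of_ne h.symm]) hf
    rw [A.side_endpoint_eq hfb t s, A.side_endpoint_eq hfb' t s]
    exact ⟨hf, hf'⟩

lemma eq_of_mem_branch {s s' : Bool} (h : A.endpoint b s = A.endpoint b' s')
    (hs : b₁ ∈ A.branch b s) (hs' : b₁ ∈ A.branch b' s') : b = b' := by
  by_contra hne
  have hsb : s = A.toward b b' := by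
    rw [← A.side_endpoint_of_ne (Ne.symm hne) s', ← h, A.side_endpoint]
  have hsb' : s' = A.toward b' b := by
    rw [← A.side_endpoint_of_ne hne s, h, A.side_endpoint]
  subst hsb hsb'
  exact Set.disjoint_left.1 (A.disjoint_branch hne) hs hs'

lemma eq_or_exists_side_ne (c t : C) :
    t = c ∨ ∃ b s, A.endpoint b s = c ∧ A.side b t ≠ s := by
  refine A.induction (fun t ↦ t = c ∨ ∃ b s, A.endpoint b s = c ∧ A.side b t ≠ s) ?_
    (c := c) (.inl rfl)
  rintro f s t (hfs | ⟨b, s', hbs', hne⟩)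
  · by_cases hts : t = s
    · exact .inl (hts ▸ hfs)
    · exact .inr ⟨f, s, hfs, by rwa [A.side_endpoint]⟩
  · by_cases hfb : f = b
    · by_cases hts : t = s'
      · exact .inl (by rw [hfb, hts, hbs'])
      · exact .inr ⟨b, s', hbs', by rwa [hfb, A.side_endpoint]⟩
    · exact .inr ⟨b, s', hbs', by rwa [A.side_endpoint_eq hfb t s]⟩

lemma exists_mem_branch (c : C) (b₁ : L) : ∃ b s, A.endpoint b s = c ∧ b₁ ∈ A.branch b s := by
  obtain h | ⟨b, s, hbs, hs⟩ := A.eq_or_exists_side_ne c (A.endpoint b₁ true)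
  · exact ⟨b₁, true, h, A.self_mem_branch b₁ true⟩
  · exact ⟨b, s, hbs, .inr hs⟩

/-- The vertices of `EdgeTree.graph`: those of the tree, and `4 |L|` new vertices `(b, b₁, i)` for
every edge `b`. -/
abbrev Vertex (L C : Type*) : Type _ := C ⊕ L × L × Fin 4

/-- Adjacency in `EdgeTree.graph`. -/
def Adj : Vertex L C → Vertex L C → Prop
  | .inl _, .inl _ => False
  | .inl c, .inr (b, b₁, _) | .inr (b, b₁, _), .inl c => ∃ s, A.endpoint b s = c ∧ b₁ ∈ A.branch b s
  | .inr (b, b₁, i), .inr (b', b₁', j) =>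
    b = b' ∧ (b₁, i) ≠ (b₁', j) ∧ ¬ (b₁ = b ∧ b₁' = b ∧ j = i.rev)

/-- The regular graph built from the tree: every edge `b` is replaced by a block with `4 |L|` new
vertices `(b, b₁, i)`, of which `endpoint b s` is joined to those with `b₁` in `branch b s`, so that
the degrees at a vertex of the tree add up to `4 |L|`. The new vertices of a block are joined
pairwise, except `(b, b, 0)` to `(b, b, 3)` and `(b, b, 1)` to `(b, b, 2)`, so that each misses
exactly one other vertex of the block. -/
def graph : SimpleGraph (Vertex L C) where
  Adj := A.Adj
  symm := ⟨by
    rintro (c | ⟨b, b₁, i⟩) (c' | ⟨b', b₁', j⟩) h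
    · exact h
    · exact h
    · exact h
    · obtain ⟨rfl, hne, hrev⟩ := h
      exact ⟨rfl, hne.symm, fun ⟨h', h, hij⟩ ↦ hrev ⟨h, h', by rw [hij, Fin.rev_rev]⟩⟩⟩
  loopless := ⟨by
    rintro (c | ⟨b, b₁, i⟩) h
    · exact h
    · exact h.2.1 rfl⟩

lemma not_adj_inl_inl {c c' : C} : ¬ A.graph.Adj (.inl c) (.inl c') := id

variable {A} {p p' : L × Fin 4}

lemma adj_inl_inr :
    A.graph.Adj (.inl c) (.inr (b, p)) ↔ ∃ s, A.endpoint b s = c ∧ p.1 ∈ A.branch b s :=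
  Iff.rfl

lemma adj_inr_inr : A.graph.Adj (.inr (b, p)) (.inr (b', p')) ↔
    b = b' ∧ p ≠ p' ∧ ¬ (p.1 = b ∧ p'.1 = b ∧ p'.2 = p.2.rev) :=
  Iff.rfl

/-- The new vertices that replace the edge `b`. -/
def interior (b : L) : Set (Vertex L C) := range fun p ↦ .inr (b, p)

variable (A) in
/-- The block that replaces the edge `b`: the new vertices at `b` and the two ends of `b`. -/
def block (b : L) : Set (Vertex L C) := interior b ∪ range fun s ↦ .inl (A.endpoint b s)

@[simp]
lemma inr_mem_interior : (.inr (b', p) : Vertex L C) ∈ interior b ↔ b' = b := by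
  simp [interior, eq_comm]

@[simp]
lemma inl_notMem_interior : (.inl c : Vertex L C) ∉ interior b := by
  simp [interior]

@[simp]
lemma inr_mem_block : .inr (b', p) ∈ A.block b ↔ b' = b := by
  simp [block]

@[simp]
lemma inl_mem_block : .inl c ∈ A.block b ↔ ∃ s, A.endpoint b s = c := by
  simp only [block, mem_union, inl_notMem_interior, mem_range, Sum.inl.injEq, false_or]

lemma inl_endpoint_mem_block (A : EdgeTree L C) (b : L) (s : Bool) :
    .inl (A.endpoint b s) ∈ A.block b :=
  .inr ⟨s, rfl⟩

lemma eq_of_block_subset (h : A.block b ⊆ A.block b') : b = b' :=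
  inr_mem_block.1 (h (inr_mem_block.2 rfl : .inr (b, b, 0) ∈ A.block b))

lemma block_injective : Function.Injective A.block := fun _ _ h ↦ eq_of_block_subset h.subset

lemma exists_mem_block [Nonempty L] (x : Vertex L C) : ∃ b, x ∈ A.block b := by
  rcases x with c | ⟨b, p⟩
  · obtain ⟨b₀⟩ := ‹Nonempty L›
    obtain ⟨b, s, hbs, -⟩ := A.exists_mem_branch c b₀
    exact ⟨b, inl_mem_block.2 ⟨s, hbs⟩⟩
  · exact ⟨b, by simp⟩

lemma exists_interior_of_adj {x y : Vertex L C} (h : A.graph.Adj x y) :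
    ∃ b, (x ∈ interior b ∨ y ∈ interior b) ∧ x ∈ A.block b ∧ y ∈ A.block b := by
  rcases x with c | ⟨b, p⟩ <;> rcases y with c' | ⟨b', p'⟩
  · exact (A.not_adj_inl_inl h).elim
  · obtain ⟨s, hs, -⟩ := adj_inl_inr.1 h
    exact ⟨b', .inr (by simp), inl_mem_block.2 ⟨s, hs⟩, by simp⟩
  · obtain ⟨s, hs, -⟩ := adj_inl_inr.1 h.symm
    exact ⟨b, .inl (by simp), by simp, inl_mem_block.2 ⟨s, hs⟩⟩
  · obtain ⟨rfl, -⟩ := adj_inr_inr.1 h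
    exact ⟨b, .inl (by simp), by simp, by simp⟩

lemma mem_block_of_adj {y : Vertex L C} (h : A.graph.Adj (.inr (b, p)) y) : y ∈ A.block b := by
  obtain ⟨b', _, hb, hb'⟩ := exists_interior_of_adj h
  exact inr_mem_block.1 hb ▸ hb'

variable (A) in
/-- The vertices outside the interior of `b` that lie on the side of `endpoint b s`. -/
def region (b : L) (s : Bool) : Set (Vertex L C)
  | .inl c => A.side b c = s
  | .inr (b', _) => b' ≠ b ∧ A.toward b b' = s

@[simp]
lemma inl_mem_region {s : Bool} : .inl c ∈ A.region b s ↔ A.side b c = s := Iff.rfl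

@[simp]
lemma inr_mem_region {s : Bool} : .inr (b', p) ∈ A.region b s ↔ b' ≠ b ∧ A.toward b b' = s :=
  Iff.rfl

lemma notMem_interior_of_mem_region {s : Bool} {x : Vertex L C} (hx : x ∈ A.region b s) :
    x ∉ interior b := by
  rcases x with c | ⟨b', p⟩
  · exact inl_notMem_interior
  · simpa using hx.1

variable (A) in
lemma exists_mem_region {x : Vertex L C} (hx : x ∉ interior b) : ∃ s, x ∈ A.region b s := by
  rcases x with c | ⟨b', p⟩
  · exact ⟨_, rfl⟩
  · exact ⟨_, by simpa using hx, rfl⟩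

lemma eq_of_adj_of_mem_region {s : Bool} {x y : Vertex L C} (hx : x ∈ A.region b s)
    (hy : y ∉ A.region b s) (h : A.graph.Adj x y) : x = .inl (A.endpoint b s) := by
  rcases x with c | ⟨b', p⟩ <;> rcases y with c' | ⟨b'', p'⟩
  · exact (A.not_adj_inl_inl h).elim
  · obtain ⟨t, rfl, -⟩ := adj_inl_inr.1 h
    by_cases hb : b'' = b
    · subst hb
      rw [inl_mem_region, A.side_endpoint] at hx
      rw [hx]
    · rw [inl_mem_region, A.side_endpoint_of_ne hb] at hx
      exact (hy ⟨hb, hx⟩).elim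
  · obtain ⟨t, rfl, -⟩ := adj_inl_inr.1 h.symm
    exact (hy ((A.side_endpoint_of_ne hx.1 t).trans hx.2)).elim
  · obtain ⟨rfl, -⟩ := adj_inr_inr.1 h
    exact (hy hx).elim

lemma subset_interior_of_connected {S : Set (Vertex L C)} (hS : (A.graph.induce S).Connected)
    {x : Vertex L C} (hxS : x ∈ S) (hx : x ∈ interior b) (hends : ∀ s, .inl (A.endpoint b s) ∉ S) :
    S ⊆ interior b := by
  intro y hyS
  by_contra hy
  obtain ⟨s, hs⟩ := A.exists_mem_region hy
  exact hends s (mem_inter_of_reachable_induce (fun _ _ ↦ eq_of_adj_of_mem_region)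
    (hS.preconnected ⟨y, hyS⟩ ⟨x, hxS⟩) hs (notMem_interior_of_mem_region · hx)).1

/-! ### Blocks and cut-vertices -/

lemma adj_core {i : Fin 4} {x : Vertex L C} (hx : x ∈ A.block b) (hne : x ≠ .inr (b, b, i))
    (hrev : x ≠ .inr (b, b, i.rev)) : A.graph.Adj x (.inr (b, b, i)) := by
  rcases x with c | ⟨b', b₁, j⟩
  · obtain ⟨s, hs⟩ := inl_mem_block.1 hx
    exact ⟨s, hs, A.self_mem_branch b s⟩
  · obtain rfl := inr_mem_block.1 hx
    refine adj_inr_inr.2 ⟨rfl, fun h ↦ hne (h ▸ rfl), ?_⟩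
    rintro ⟨h, -, hij⟩
    exact hrev (by rw [show i = j.rev from hij, Fin.rev_rev, ← h])

lemma block_isTwoConnectedOn (b : L) : A.graph.IsTwoConnectedOn (A.block b) := by
  have adj_or {i j : Fin 4} (hij : i ≠ j) (hrev : i ≠ j.rev) (x) (hx : x ∈ A.block b) :
      A.graph.Adj x (.inr (b, b, i)) ∨ A.graph.Adj x (.inr (b, b, j)) := by
    by_cases hxi : x = .inr (b, b, i) ∨ x = .inr (b, b, i.rev)
    · right
      refine adj_core hx ?_ ?_ <;> rcases hxi with rfl | rfl <;> simp [Fin.rev_eq_iff, *]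
    · push Not at hxi
      exact .inl (adj_core hx hxi.1 hxi.2)
  refine isTwoConnectedOn_of_dominating_edges (a := .inr (b, b, 0)) (b := .inr (b, b, 1))
    (a' := .inr (b, b, 2)) (b' := .inr (b, b, 3)) ?_ ?_ ?_ ?_
    (adj_or (by decide) (by decide)) (adj_or (by decide) (by decide))
  · simp [insert_subset_iff]
  · exact adj_core (by simp) (by simp) (by simp)
  · exact adj_core (by simp) (by simp) (by simp)
  · simp

lemma exists_subset_block {S : Set (Vertex L C)} (hS : A.graph.IsTwoConnectedOn S) :
    ∃ b, S ⊆ A.block b := by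
  have : Nontrivial S :=
    (one_lt_encard_iff_nontrivial.1 (lt_of_lt_of_le (by norm_num) hS.1)).coe_sort
  obtain ⟨x⟩ := hS.2.1.nonempty
  obtain ⟨y, hxy : A.graph.Adj x y⟩ := hS.2.1.preconnected.exists_adj_of_nontrivial x
  obtain ⟨b, hinterior, -⟩ := exists_interior_of_adj hxy
  obtain ⟨z, hzS, hz⟩ : ∃ z ∈ S, z ∈ interior b :=
    hinterior.elim (⟨x, x.2, ·⟩) (⟨y, y.2, ·⟩)
  refine ⟨b, fun w hw ↦ ?_⟩
  by_cases hwint : w ∈ interior b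
  · exact .inl hwint
  obtain ⟨s, hs⟩ := A.exists_mem_region hwint
  obtain hsub | hsub := subset_or_inter_subset_of_isTwoConnectedOn
    (fun _ _ ↦ eq_of_adj_of_mem_region (b := b) (s := s)) hS
  · exact (notMem_interior_of_mem_region (hsub hzS) hz).elim
  · exact .inr ⟨s, (hsub ⟨hw, hs⟩).symm⟩

lemma isBlock_iff {S : Set (Vertex L C)} : A.graph.IsBlock S ↔ S ∈ range A.block :=
  isBlock_iff_mem_range block_isTwoConnectedOn
    (fun _ _ h ↦ let ⟨b, _, hb⟩ := exists_interior_of_adj h; ⟨b, hb⟩)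
    (fun _ ↦ exists_subset_block) (fun _ _ ↦ eq_of_block_subset)

lemma block_inter_connected {v : Vertex L C} (b : L) :
    (A.graph.induce (A.block b ∩ {v}ᶜ)).Connected := by
  rw [← sdiff_eq]
  by_cases hv : v ∈ A.block b
  · exact (block_isTwoConnectedOn b).2.2 v hv
  · rw [sdiff_singleton_eq_self hv]
    exact (block_isTwoConnectedOn b).2.1

lemma connected_induce_of_block_inter [Nonempty L] {P : Set (Vertex L C)}
    (hP : ∀ b, (A.graph.induce (A.block b ∩ P)).Connected)
    (hends : ∀ ⦃c⦄, .inl c ∉ P → ∀ ⦃b b'⦄, .inl c ∈ A.block b → .inl c ∈ A.block b' → b = b') :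
    (A.graph.induce P).Connected := by
  obtain ⟨b₀⟩ := ‹Nonempty L›
  obtain ⟨x₀, hx₀⟩ := (hP b₀).nonempty
  let Reached (b : L) : Prop := ∀ y, ∀ hy : y ∈ A.block b ∩ P,
    (A.graph.induce P).Reachable ⟨x₀, hx₀.2⟩ ⟨y, hy.2⟩
  have reached_of_reachable {b : L} {x : Vertex L C} (hx : x ∈ A.block b ∩ P)
      (h : (A.graph.induce P).Reachable ⟨x₀, hx₀.2⟩ ⟨x, hx.2⟩) : Reached b := fun y hy ↦
    h.trans (reachable_induce_of_subset (hP b) inter_subset_right hx hy)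
  have reached₀ : Reached b₀ := reached_of_reachable hx₀ .rfl
  have reached_trans {b b' : L} {c : C} (hb : Reached b) (hc : .inl c ∈ A.block b)
      (hc' : .inl c ∈ A.block b') : Reached b' := by
    by_cases hcP : .inl c ∈ P
    · exact reached_of_reachable ⟨hc', hcP⟩ (hb _ ⟨hc, hcP⟩)
    · exact hends hcP hc hc' ▸ hb
  have reached_of_mem (c : C) : ∀ b, .inl c ∈ A.block b → Reached b := by
    refine A.induction (fun c ↦ ∀ b, .inl c ∈ A.block b → Reached b) (fun b s t h b' hb' ↦ ?_)
      (c := A.endpoint b₀ true) fun b hb ↦ reached_trans reached₀ (A.inl_endpoint_mem_block _ _) hb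
    exact reached_trans (h b (A.inl_endpoint_mem_block _ _)) (A.inl_endpoint_mem_block _ _) hb'
  have reachable (y : P) : (A.graph.induce P).Reachable ⟨x₀, hx₀.2⟩ y := by
    obtain ⟨b, hb⟩ := exists_mem_block y.1
    exact reached_of_mem _ b (A.inl_endpoint_mem_block b true) y ⟨hb, y.2⟩
  exact (connected_iff _).2 ⟨fun y z ↦ (reachable y).symm.trans (reachable z), ⟨x₀, hx₀.2⟩⟩

lemma graph_connected [Nonempty L] : A.graph.Connected := by
  rw [← A.graph.induceUnivIso.connected_iff]
  refine connected_induce_of_block_inter (fun b ↦ ?_) fun c hc ↦ (hc trivial).elim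
  rw [inter_univ]
  exact (block_isTwoConnectedOn b).2.1

variable (A) in
/-- The vertex `c` of the tree is not a leaf: it is an end of two different edges. -/
def IsInternal (c : C) : Prop := ∃ b b', b ≠ b' ∧ .inl c ∈ A.block b ∧ .inl c ∈ A.block b'

lemma isCutVertex_iff [Nonempty L] {v : Vertex L C} :
    A.graph.IsCutVertex v ↔ ∃ c, v = .inl c ∧ A.IsInternal c := by
  constructor
  · rintro ⟨x, y, hx, hy, -, hxy⟩
    by_contra! hv
    refine hxy ((connected_induce_of_block_inter block_inter_connected ?_).preconnected _ _)
    intro c hc b b' hb hb'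
    by_contra hne
    exact hv c (notMem_compl_iff.1 hc).symm ⟨b, b', hne, hb, hb'⟩
  · rintro ⟨c, rfl, b, b', hne, hb, hb'⟩
    refine ⟨.inr (b', b', 0), .inr (b, b, 0), by simp, by simp, graph_connected.preconnected _ _,
      fun h ↦ ?_⟩
    obtain ⟨s, rfl⟩ := inl_mem_block.1 hb
    obtain ⟨s', hs'⟩ := inl_mem_block.1 hb'
    have hside : A.toward b b' = s := by
      rw [← A.side_endpoint_of_ne hne.symm s', hs', A.side_endpoint]
    exact (mem_inter_of_reachable_induce (fun _ _ ↦ eq_of_adj_of_mem_region (b := b) (s := s)) h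
      ⟨hne.symm, hside⟩ (notMem_interior_of_mem_region · (inr_mem_interior.2 rfl))).1 rfl

end EdgeTree

section BipartiteGraphs

open SimpleGraph

variable {α β α' β' : Type*}

/-- The bipartite graph on `α ⊕ β` in which `a : α` is adjacent to `b : β` whenever `R a b`. -/
def bipartiteGraphOfRel (R : α → β → Prop) : SimpleGraph (α ⊕ β) where
  Adj
    | .inl a, .inr b | .inr b, .inl a => R a b
    | _, _ => False
  symm := ⟨by rintro (a | b) (a' | b') h <;> exact h⟩
  loopless := ⟨by rintro (a | b) h <;> exact h⟩

/-- Bijections between the parts that respect the relations give an isomorphism of the bipartite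
graphs. -/
def bipartiteGraphOfRelIso {R : α → β → Prop} {R' : α' → β' → Prop} (f : α ≃ α') (g : β ≃ β')
    (h : ∀ a b, R' (f a) (g b) ↔ R a b) : bipartiteGraphOfRel R ≃g bipartiteGraphOfRel R' where
  toEquiv := Equiv.sumCongr f g
  map_rel_iff' := by rintro (a | b) (a' | b') <;> first | exact h _ _ | exact Iff.rfl

variable {V : Type*} {G : SimpleGraph V}

lemma blockGraph_eq_bipartiteGraphOfRel :
    G.blockGraph = bipartiteGraphOfRel fun b c ↦ c.1 ∈ b.1 := by
  ext (b | c) (b' | c') <;> simp [blockGraph, bipartiteGraphOfRel]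

lemma nonempty_iso_bipartiteGraphOfRel {s t : Set V} (h : G.IsBipartiteWith s t)
    (hst : s ∪ t = Set.univ) :
    Nonempty (bipartiteGraphOfRel (fun (a : s) (b : t) ↦ G.Adj a b) ≃g G) := by
  have hbij : Function.Bijective (Sum.elim Subtype.val Subtype.val : s ⊕ t → V) := by
    refine ⟨Subtype.val_injective.sumElim Subtype.val_injective fun a b hab ↦ ?_, fun v ↦ ?_⟩
    · exact Set.disjoint_left.1 h.disjoint a.2 (hab ▸ b.2)
    · exact (Set.eq_univ_iff_forall.1 hst v).elim (⟨.inl ⟨v, ·⟩, rfl⟩) (⟨.inr ⟨v, ·⟩, rfl⟩)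
  refine ⟨⟨Equiv.ofBijective _ hbij, ?_⟩⟩
  rintro (a | a) (b | b)
  · exact iff_of_false (fun hab ↦ Set.disjoint_left.1 h.disjoint b.2 (h.mem_of_mem_adj a.2 hab)) id
  · exact Iff.rfl
  · exact G.adj_comm _ _
  · exact iff_of_false
      (fun hab ↦ Set.disjoint_left.1 h.disjoint (h.symm.mem_of_mem_adj a.2 hab) b.2) id

end BipartiteGraphs

namespace EdgeTree

open SimpleGraph Set

variable {L C : Type*} (A : EdgeTree L C)

/-- The tree with every edge subdivided and its leaves deleted: its vertices are the edges and the
internal vertices of the tree, and adjacency is incidence. -/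
def prunedSubdivision : SimpleGraph (L ⊕ {c // A.IsInternal c}) :=
  bipartiteGraphOfRel fun b c ↦ .inl c.1 ∈ A.block b

variable {A} in
lemma exists_isInternal_of_adj {x y : L ⊕ {c // A.IsInternal c}} (h : A.prunedSubdivision.Adj x y) :
    ∃ c, A.IsInternal c :=
  match x, y with
  | .inl _, .inr c | .inr c, .inl _ => ⟨c, c.2⟩
  | .inl _, .inl _ | .inr _, .inr _ => h.elim

lemma nonempty_prunedSubdivision_iso_blockGraph [Nonempty L] :
    Nonempty (A.prunedSubdivision ≃g A.graph.blockGraph) := by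
  let f : L ≃ {S // A.graph.IsBlock S} :=
    (Equiv.ofInjective _ block_injective).trans (Equiv.subtypeEquivRight fun _ ↦ isBlock_iff.symm)
  have hinl : Function.Injective (.inl : C → Vertex L C) := Sum.inl_injective
  let g : {c // A.IsInternal c} ≃ {v // A.graph.IsCutVertex v} :=
    (Equiv.ofBijective (fun c ↦ ⟨.inl c.1, isCutVertex_iff.2 ⟨c, rfl, c.2⟩⟩)
      ⟨fun c c' h ↦ Subtype.ext (hinl (congrArg Subtype.val h)), fun ⟨v, hv⟩ ↦ by
        obtain ⟨c, rfl, hc⟩ := isCutVertex_iff.1 hv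
        exact ⟨⟨c, hc⟩, rfl⟩⟩)
  rw [blockGraph_eq_bipartiteGraphOfRel]
  exact ⟨bipartiteGraphOfRelIso f g fun _ _ ↦ Iff.rfl⟩

end EdgeTree

namespace EdgeTree

open SimpleGraph Set

/-! ### Regularity -/

variable {L C : Type*} {A : EdgeTree L C}

lemma finite_block [Finite L] (b : L) : (A.block b).Finite :=
  (finite_range _).union (finite_range _)

variable (A) in
lemma ncard_block [Finite L] (b : L) : (A.block b).ncard = 4 * Nat.card L + 2 := by
  have hdisj : Disjoint (interior b) (range fun s ↦ (.inl (A.endpoint b s) : Vertex L C)) := by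
    simp [interior, Set.disjoint_left]
  have hinterior : (interior b : Set (Vertex L C)).ncard = 4 * Nat.card L :=
    (ncard_range_of_injective (Sum.inr_injective.comp (Prod.mk_right_injective b))).trans
      (by rw [Nat.card_prod, Nat.card_fin, mul_comm])
  have hends : (range fun s ↦ (.inl (A.endpoint b s) : Vertex L C)).ncard = 2 :=
    (ncard_range_of_injective (Sum.inl_injective.comp (A.endpoint_injective b))).trans
      (by rw [Nat.card_eq_fintype_card, Fintype.card_bool])
  rw [block, ncard_union_eq hdisj (finite_range _) (finite_range _), hinterior, hends]

variable (A) in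
lemma exists_neighborSet_inr_eq (b : L) (p : L × Fin 4) : ∃ y ∈ A.block b, y ≠ .inr (b, p) ∧
    A.graph.neighborSet (.inr (b, p)) = A.block b \ {.inr (b, p), y} := by
  suffices ∃ y ∈ A.block b, y ≠ .inr (b, p) ∧ ¬ A.graph.Adj (.inr (b, p)) y ∧
      ∀ x ∈ A.block b, x ≠ .inr (b, p) → x ≠ y → A.graph.Adj (.inr (b, p)) x by
    obtain ⟨y, hy, hne, hnadj, hadj⟩ := this
    refine ⟨y, hy, hne, Subset.antisymm (fun x hx ↦ ⟨mem_block_of_adj hx, ?_⟩) fun x hx ↦ ?_⟩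
    · rintro (rfl | rfl)
      · exact A.graph.irrefl ((A.graph.mem_neighborSet _ _).1 hx)
      · exact hnadj hx
    · exact hadj x hx.1 (fun h ↦ hx.2 (.inl h)) fun h ↦ hx.2 (.inr h)
  obtain ⟨b₁, i⟩ := p
  by_cases hb : b₁ = b
  · subst hb
    have hrev : i.rev ≠ i := by decide +revert
    refine ⟨.inr (b₁, b₁, i.rev), by simp, by simp [hrev], ?_,
      fun x hx hne hrev ↦ (adj_core hx hne hrev).symm⟩
    exact fun h ↦ h.2.2 ⟨rfl, rfl, rfl⟩
  · refine ⟨.inl (A.endpoint b (A.toward b b₁)), A.inl_endpoint_mem_block _ _, by simp, ?_, ?_⟩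
    · rintro ⟨s, hs, hs'⟩
      obtain rfl := A.endpoint_injective b hs
      exact hs'.elim hb (· rfl)
    · rintro (c | ⟨b', p⟩) hx hne hy
      · obtain ⟨s, rfl⟩ := inl_mem_block.1 hx
        exact ⟨s, rfl, .inr fun h ↦ hy (h ▸ rfl)⟩
      · obtain rfl := inr_mem_block.1 hx
        exact ⟨rfl, fun h ↦ hne (congrArg (fun q ↦ Sum.inr (b', q)) h.symm), fun h ↦ hb h.1⟩

lemma ncard_neighborSet_inl (c : C) : (A.graph.neighborSet (.inl c)).ncard = 4 * Nat.card L := by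
  choose entry s hs hentry using A.exists_mem_branch c
  have hrange : A.graph.neighborSet (.inl c) =
      range fun p : L × Fin 4 ↦ .inr (entry p.1, p) := by
    ext (c' | ⟨b, p⟩)
    · simp [A.not_adj_inl_inl]
    · simp only [mem_neighborSet, adj_inl_inr, mem_range, Sum.inr.injEq, Prod.mk.injEq]
      constructor
      · rintro ⟨t, rfl, ht⟩
        exact ⟨p, A.eq_of_mem_branch (hs p.1) (hentry p.1) ht, rfl⟩
      · rintro ⟨_, rfl, rfl⟩
        exact ⟨_, hs _, hentry _⟩
  have hinj : Function.Injective fun p : L × Fin 4 ↦ (.inr (entry p.1, p) : Vertex L C) :=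
    fun p p' h ↦ (Prod.mk.inj (Sum.inr_injective h)).2
  rw [hrange, ncard_range_of_injective hinj, Nat.card_prod, Nat.card_fin, mul_comm]

lemma ncard_neighborSet [Finite L] (x : Vertex L C) :
    (A.graph.neighborSet x).ncard = 4 * Nat.card L := by
  rcases x with c | ⟨b, p⟩
  · exact ncard_neighborSet_inl c
  · obtain ⟨y, hy, hne, hnbr⟩ := A.exists_neighborSet_inr_eq b p
    have hsub : {.inr (b, p), y} ⊆ A.block b := pair_subset (by simp) hy
    rw [hnbr, ncard_sdiff hsub (toFinite _), A.ncard_block, ncard_pair hne.symm, Nat.add_sub_cancel]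

end EdgeTree

namespace EdgeTree

open SimpleGraph Set

/-! ### Minors of large minimum degree -/

variable {L C W : Type*} {A : EdgeTree L C} {K : SimpleGraph W} {B : W → Set (Vertex L C)}
  {b b' : L} {w w' : W}

lemma neighborSet_subset_of_subset_interior (hB : IsMinorModel K A.graph B)
    (hw : B w ⊆ interior b) :
    K.neighborSet w ⊆ {w' | (B w' ∩ A.block b).Nonempty} \ {w} := fun w' hww' ↦ by
  obtain ⟨x, hx, y, hy, hxy⟩ := hB.exists_adj hww'
  obtain ⟨p, rfl⟩ := hw hx
  exact ⟨⟨y, hy, mem_block_of_adj hxy⟩, hww'.ne'⟩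

lemma ncard_block_le_of_subset_interior [Finite L] [Finite W] (hB : IsMinorModel K A.graph B)
    (hdeg : 4 * Nat.card L ≤ (K.neighborSet w).ncard) (hw : B w ⊆ interior b) :
    (A.block b).ncard ≤ {w' | (B w' ∩ A.block b).Nonempty}.ncard + 1 := by
  obtain ⟨x, hx⟩ := hB.nonempty w
  have hmeet : w ∈ {w' | (B w' ∩ A.block b).Nonempty} := ⟨x, hx, .inl (hw hx)⟩
  calc (A.block b).ncard = 4 * Nat.card L + 1 + 1 := A.ncard_block b
    _ ≤ ({w' | (B w' ∩ A.block b).Nonempty} \ {w}).ncard + 1 + 1 := by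
        grw [hdeg, ncard_le_ncard (neighborSet_subset_of_subset_interior hB hw)]
    _ = {w' | (B w' ∩ A.block b).Nonempty}.ncard + 1 := by
        rw [ncard_sdiff_singleton_add_one hmeet]

lemma adj_of_inter_block_eq_singleton [Finite L] [Finite W] (hB : IsMinorModel K A.graph B)
    (hdeg : 4 * Nat.card L ≤ (K.neighborSet w).ncard)
    (hcard : (A.block b).ncard = {w' | (B w' ∩ A.block b).Nonempty}.ncard + 1)
    {x y : Vertex L C} (hx : x ∈ interior b) (hxy : x ≠ y) (hwx : B w ∩ A.block b = {x})
    (hwy : B w' ∩ A.block b = {y}) : A.graph.Adj x y := by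
  have hxw : x ∈ B w ∩ A.block b := hwx ▸ rfl
  have hyw' : y ∈ B w' ∩ A.block b := hwy ▸ rfl
  have hw : B w ⊆ interior b := subset_interior_of_connected (hB.connected w) hxw.1 hx fun s hs ↦
    inl_notMem_interior ((hwx.subset ⟨hs, A.inl_endpoint_mem_block b s⟩ : _ = x) ▸ hx)
  have hneighbors : K.neighborSet w = {w' | (B w' ∩ A.block b).Nonempty} \ {w} := by
    refine eq_of_subset_of_ncard_le (neighborSet_subset_of_subset_interior hB hw) ?_
    have := A.ncard_block b
    have hmeet : w ∈ {w' | (B w' ∩ A.block b).Nonempty} := ⟨x, hxw⟩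
    have := ncard_sdiff_singleton_add_one hmeet
    omega
  have hww' : w' ∈ K.neighborSet w := by
    refine hneighbors ▸ ⟨⟨y, hyw'⟩, ?_⟩
    rintro rfl
    exact hxy (singleton_injective (hwx.symm.trans hwy))
  obtain ⟨x', hx', y', hy', hadj⟩ := hB.exists_adj hww'
  obtain rfl : x' = x := hwx.subset ⟨hx', .inl (hw hx')⟩
  obtain ⟨p, rfl⟩ := hx
  obtain rfl : y' = y := hwy.subset ⟨hy', mem_block_of_adj hadj⟩
  exact hadj

variable (A) in
lemma exists_not_adj_ne [Nontrivial L] (b : L) (u z : Vertex L C) : ∃ x ∈ interior b,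
    ∃ y ∈ A.block b, ¬ A.graph.Adj x y ∧ x ≠ y ∧ x ≠ u ∧ x ≠ z ∧ y ≠ u ∧ y ≠ z := by
  obtain ⟨b₁, hb₁⟩ := exists_ne b
  have not_adj_core (i : Fin 4) : ¬ A.graph.Adj (.inr (b, b, i)) (.inr (b, b, i.rev)) :=
    fun h ↦ h.2.2 ⟨rfl, rfl, rfl⟩
  have not_adj_end : ¬ A.graph.Adj (.inr (b, b₁, 0)) (.inl (A.endpoint b (A.toward b b₁))) := by
    rintro ⟨s, hs, h⟩
    obtain rfl := A.endpoint_injective b hs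
    exact h.elim hb₁ (· rfl)
  by_contra! h
  have h₁ := h (.inr (b, b, 0)) (by simp) (.inr (b, b, 3)) (by simp) (not_adj_core 0) (by simp)
  have h₂ := h (.inr (b, b, 1)) (by simp) (.inr (b, b, 2)) (by simp) (not_adj_core 1) (by simp)
  have h₃ := h _ (by simp) _ (A.inl_endpoint_mem_block _ _) not_adj_end (by simp)
  clear h not_adj_core not_adj_end
  -- the three pairs are disjoint, so `u` and `z` cannot meet all of them
  grind [Sum.inl.injEq, Sum.inr.injEq, Prod.mk.injEq]

lemma isPreserved_block_of_subset_interior [Finite L] [Nontrivial L] [Finite W]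
    (hB : IsMinorModel K A.graph B) (hdeg : ∀ w, 4 * Nat.card L ≤ (K.neighborSet w).ncard)
    (hw : B w ⊆ interior b) : IsPreserved B (A.block b) := by
  by_contra hpres
  obtain ⟨hcard, u, z, hsingleton⟩ := ncard_eq_and_exists_pair_of_not_isPreserved
    hB.pairwise_disjoint (finite_block b) (ncard_block_le_of_subset_interior hB (hdeg w) hw) hpres
  obtain ⟨x, hx, y, hy, hnadj, hxy, hxu, hxz, hyu, hyz⟩ := A.exists_not_adj_ne b u z
  obtain ⟨w₁, hw₁⟩ := hsingleton x (.inl hx) hxu hxz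
  obtain ⟨w₂, hw₂⟩ := hsingleton y hy hyu hyz
  exact hnadj (adj_of_inter_block_eq_singleton hB (hdeg w₁) hcard hx hxy hw₁ hw₂)

lemma exists_endpoint_mem_of_not_isPreserved [Finite L] [Nontrivial L] [Finite W]
    (hB : IsMinorModel K A.graph B) (hdeg : ∀ w, 4 * Nat.card L ≤ (K.neighborSet w).ncard)
    (hpres : ¬ IsPreserved B (A.block b)) (hw : (B w ∩ A.block b).Nonempty) :
    ∃ s, .inl (A.endpoint b s) ∈ B w := by
  obtain ⟨x, hxw, hx | ⟨s, rfl⟩⟩ := hw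
  · by_contra! hends
    exact hpres (isPreserved_block_of_subset_interior hB hdeg
      (subset_interior_of_connected (hB.connected w) hxw hx hends))
  · exact ⟨s, hxw⟩

lemma toward_eq_of_endpoint_mem {S : Set (Vertex L C)} (hS : (A.graph.induce S).Connected)
    {s s' : Bool} (hne : b ≠ b') (hb : .inl (A.endpoint b s) ∈ S)
    (hb_not : .inl (A.endpoint b !s) ∉ S) (hb' : .inl (A.endpoint b' s') ∈ S) :
    A.toward b b' = s := by
  by_contra hs
  refine hb_not (mem_inter_of_reachable_induce (R := A.region b !s)
    (fun _ _ ↦ eq_of_adj_of_mem_region) (hS.preconnected ⟨_, hb'⟩ ⟨_, hb⟩) ?_ ?_).1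
  · rw [inl_mem_region, A.side_endpoint_of_ne hne.symm, Bool.eq_not]
    exact hs
  · rw [inl_mem_region, A.side_endpoint]
    simp

variable (A) in
/-- `A.IsSlot B w w' b s p` says how the branch sets `B w` and `B w'` of adjacent vertices are
joined inside the block of `b`, where `B w` contains `endpoint b s` but not the other end of `b`. If
the block is preserved, then `B w'` contains the new vertex `(b, p)`; otherwise `B w'` contains the
other end of `b`, and `p` is `(b, 0)` by convention. -/
structure IsSlot (B : W → Set (Vertex L C)) (w w' : W) (b : L) (s : Bool) (p : L × Fin 4) :
    Prop where
  endpoint_mem : .inl (A.endpoint b s) ∈ B w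
  endpoint_notMem : .inl (A.endpoint b !s) ∉ B w
  mem_branch : p.1 ∈ A.branch b s
  inr_mem : IsPreserved B (A.block b) → .inr (b, p) ∈ B w'
  eq_and_endpoint_mem : ¬ IsPreserved B (A.block b) → p = (b, 0) ∧ .inl (A.endpoint b !s) ∈ B w'

lemma exists_isSlot [Finite L] [Nontrivial L] [Finite W]
    (hB : IsMinorModel K A.graph B) (hdeg : ∀ w, 4 * Nat.card L ≤ (K.neighborSet w).ncard)
    {c : C} (hc : .inl c ∈ B w) (hww' : K.Adj w w') : ∃ b s p, A.IsSlot B w w' b s p := by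
  obtain ⟨x, hx, y, hy, hxy⟩ := hB.exists_adj hww'
  obtain ⟨b, -, hxb, hyb⟩ := exists_interior_of_adj hxy
  by_cases hpres : IsPreserved B (A.block b)
  · obtain ⟨w₁, hw₁⟩ := hpres x hxb
    obtain rfl : w = w₁ := hB.eq_of_mem hx (hw₁.symm.subset rfl).1
    have endpoint_eq {s : Bool} (hs : .inl (A.endpoint b s) ∈ B w) : .inl (A.endpoint b s) = x :=
      hw₁.subset ⟨hs, A.inl_endpoint_mem_block b s⟩
    have hxint : x ∉ interior b := fun h ↦ inl_notMem_interior <|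
      subset_interior_of_connected (hB.connected w) hx h
        (fun s hs ↦ inl_notMem_interior (endpoint_eq hs ▸ h)) hc
    obtain ⟨s, rfl⟩ := hxb.resolve_left hxint
    rcases y with c' | ⟨b', p⟩
    · exact (A.not_adj_inl_inl hxy).elim
    obtain rfl := inr_mem_block.1 hyb
    obtain ⟨t, ht, hp⟩ := adj_inl_inr.1 hxy
    obtain rfl := A.endpoint_injective _ ht
    refine ⟨b', t, p, hx, fun h ↦ ?_, hp, fun _ ↦ hy, fun h ↦ (h hpres).elim⟩
    simpa using A.endpoint_injective _ (Sum.inl_injective (endpoint_eq h))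
  · obtain ⟨s, hs⟩ := exists_endpoint_mem_of_not_isPreserved hB hdeg hpres ⟨x, hx, hxb⟩
    obtain ⟨t, ht⟩ := exists_endpoint_mem_of_not_isPreserved hB hdeg hpres ⟨y, hy, hyb⟩
    obtain rfl : t = !s := Bool.eq_not.2 fun hts ↦ hww'.ne (hB.eq_of_mem hs (hts ▸ ht))
    exact ⟨b, s, (b, 0), hs, fun h ↦ hww'.ne (hB.eq_of_mem h ht), A.self_mem_branch b s,
      fun h ↦ (hpres h).elim, fun _ ↦ ⟨rfl, ht⟩⟩

lemma IsSlot.unique {s s' : Bool} {p : L × Fin 4} {w'' : W} (hB : IsMinorModel K A.graph B)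
    (h : A.IsSlot B w w' b s p) (h' : A.IsSlot B w w'' b' s' p) : w' = w'' := by
  by_cases hne : b = b'
  · subst hne
    obtain rfl : s = s' := by
      by_contra hs
      exact h.endpoint_notMem (Bool.eq_not.2 (Ne.symm hs) ▸ h'.endpoint_mem)
    by_cases hpres : IsPreserved B (A.block b)
    · exact hB.eq_of_mem (h.inr_mem hpres) (h'.inr_mem hpres)
    · exact hB.eq_of_mem (h.eq_and_endpoint_mem hpres).2 (h'.eq_and_endpoint_mem hpres).2
  · have hs := toward_eq_of_endpoint_mem (hB.connected w) hne h.endpoint_mem h.endpoint_notMem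
      h'.endpoint_mem
    have hs' := toward_eq_of_endpoint_mem (hB.connected w) (Ne.symm hne) h'.endpoint_mem
      h'.endpoint_notMem h.endpoint_mem
    exact (Set.disjoint_left.1 (A.disjoint_branch hne) (hs ▸ h.mem_branch)
      (hs' ▸ h'.mem_branch)).elim

lemma exists_isSlot_of_endpoint_mem [Finite L] [Nontrivial L] [Finite W]
    (hB : IsMinorModel K A.graph B) (hdeg : ∀ w, 4 * Nat.card L ≤ (K.neighborSet w).ncard)
    {c : C} (hc : .inl c ∈ B w) (p : L × Fin 4) : ∃ w' b s, A.IsSlot B w w' b s p := by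
  choose b s q hslot using fun w' : K.neighborSet w ↦ exists_isSlot hB hdeg hc w'.2
  have hinj : Function.Injective q := fun w₁ w₂ h ↦
    Subtype.ext ((hslot w₁).unique hB (h ▸ hslot w₂))
  have hbij : Function.Bijective q := hinj.bijective_of_nat_card_le (by
    rw [Nat.card_prod, Nat.card_fin, mul_comm, Nat.card_coe_set_eq]
    exact hdeg w)
  obtain ⟨w', rfl⟩ := hbij.surjective p
  exact ⟨w', b w', s w', hslot w'⟩

lemma isPreserved_block_of_endpoint_mem [Finite L] [Nontrivial L] [Finite W]
    (hB : IsMinorModel K A.graph B) (hdeg : ∀ w, 4 * Nat.card L ≤ (K.neighborSet w).ncard)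
    {s : Bool} (hs : .inl (A.endpoint b s) ∈ B w) : IsPreserved B (A.block b) := by
  by_contra hpres
  obtain ⟨w', b', s', hslot⟩ := exists_isSlot_of_endpoint_mem hB hdeg hs (b, 1)
  have hpres' : IsPreserved B (A.block b') := by
    by_contra h
    simpa using (hslot.eq_and_endpoint_mem h).1
  have hne : b' ≠ b := fun h ↦ hpres (h ▸ hpres')
  exact hslot.mem_branch.elim (fun h ↦ hne h.symm) fun h ↦ h (toward_eq_of_endpoint_mem
    (hB.connected w) hne hslot.endpoint_mem hslot.endpoint_notMem hs)

lemma isPreserved_block [Finite L] [Nontrivial L] [Finite W] [Nonempty W]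
    (hB : IsMinorModel K A.graph B) (hdeg : ∀ w, 4 * Nat.card L ≤ (K.neighborSet w).ncard)
    (b : L) : IsPreserved B (A.block b) := by
  have endpoint_mem {b : L} (hb : IsPreserved B (A.block b)) (s : Bool) :
      ∃ w, .inl (A.endpoint b s) ∈ B w := by
    obtain ⟨w, hw⟩ := hb _ (A.inl_endpoint_mem_block b s)
    exact ⟨w, (hw.symm.subset rfl).1⟩
  obtain ⟨b₀, hb₀⟩ : ∃ b, IsPreserved B (A.block b) := by
    obtain ⟨w⟩ := ‹Nonempty W›
    obtain ⟨x, hx⟩ := hB.nonempty w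
    obtain ⟨b, hb⟩ := exists_mem_block (A := A) x
    by_contra! hpres
    obtain ⟨s, hs⟩ := exists_endpoint_mem_of_not_isPreserved hB hdeg (hpres b) ⟨x, hx, hb⟩
    exact hpres b (isPreserved_block_of_endpoint_mem hB hdeg hs)
  obtain ⟨w, hw⟩ : ∃ w, .inl (A.endpoint b true) ∈ B w := by
    refine A.induction (fun c ↦ ∃ w, .inl c ∈ B w) (fun b s t ↦ ?_) (endpoint_mem hb₀ true)
    rintro ⟨w, hw⟩
    exact endpoint_mem (isPreserved_block_of_endpoint_mem hB hdeg hw) t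
  exact isPreserved_block_of_endpoint_mem hB hdeg hw

lemma card_le_card_of_isMinor [Finite L] [Nontrivial L] [Finite W] [Nonempty W]
    (hK : K.IsMinor A.graph) (hdeg : ∀ w, 4 * Nat.card L ≤ (K.neighborSet w).ncard) :
    Nat.card (Vertex L C) ≤ Nat.card W := by
  obtain ⟨B, hB⟩ := isMinor_iff_exists_isMinorModel.1 hK
  refine card_le_card_of_subsingleton (hB.subsingleton_of_isPreserved fun x y hxy ↦ ?_) fun x ↦ ?_
  · obtain ⟨b, -, hx, hy⟩ := exists_interior_of_adj hxy
    exact ⟨A.block b, hx, hy, isPreserved_block hB hdeg b⟩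
  · obtain ⟨b, hb⟩ := exists_mem_block (A := A) x
    obtain ⟨w, hw⟩ := isPreserved_block hB hdeg b x hb
    exact ⟨w, (hw.symm.subset rfl).1⟩

end EdgeTree

open SimpleGraph Set

section LowHigh

variable {U U' : Type*} {T : SimpleGraph U} {T' : SimpleGraph U'} {Vl Vh : Set U}

lemma isLowHighTree_of_iso [Fintype U] [Fintype U'] [DecidableRel T.Adj] [DecidableRel T'.Adj]
    (f : T ≃g T') (hT : T.IsLowHighTree) : T'.IsLowHighTree := by
  obtain ⟨htree, Vl, Vh, hunion, hbip, hlow, hhigh⟩ := hT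
  refine ⟨f.isTree_iff.1 htree, f.symm ⁻¹' Vl, f.symm ⁻¹' Vh, ?_, ⟨?_, ?_⟩, ?_, ?_⟩
  · rw [← preimage_union, hunion, preimage_univ]
  · exact hbip.disjoint.preimage _
  · exact fun v w hvw ↦ hbip.mem_of_adj (f.symm.map_adj_iff.2 hvw)
  · exact fun v hv ↦ f.symm.degree_eq v ▸ hlow _ hv
  · exact fun v hv ↦ f.symm.degree_eq v ▸ hhigh _ hv

/-- The ends of the low vertices of `T`, regarded as the edges of an auxiliary tree: `e b true` and
`e b false` are the neighbours of `b`, except that `e b false` is `b` itself if `b` has degree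
one. -/
structure IsEndMap (T : SimpleGraph U) (Vl : Set U) (e : Vl → Bool → U) : Prop where
  adj_true (b : Vl) : T.Adj b (e b true)
  eq_or_adj (b : Vl) (s : Bool) : e b s = b ∨ T.Adj b (e b s)
  ne (b : Vl) : e b false ≠ e b true
  exists_eq_of_adj {b : Vl} {x : U} (h : T.Adj b x) : ∃ s, e b s = x

lemma exists_isEndMap [Fintype U] [DecidableRel T.Adj] (hpos : ∀ v ∈ Vl, 0 < T.degree v)
    (hlow : ∀ v ∈ Vl, T.degree v ≤ 2) : ∃ e, IsEndMap T Vl e := by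
  classical
  have exists_ends (b : Vl) : ∃ x y, T.Adj b x ∧ (y = b.1 ∨ T.Adj b y) ∧ y ≠ x ∧
      ∀ z, T.Adj b z → z = x ∨ z = y := by
    simp only [← mem_neighborFinset]
    have hpos := hpos b b.2
    have hlow := hlow b b.2
    obtain h | h : T.degree b = 1 ∨ T.degree b = 2 := by omega
    · obtain ⟨x, hx⟩ := Finset.card_eq_one.1 h
      refine ⟨x, b, by simp [hx], .inl rfl, ?_, by simp +contextual [hx]⟩
      exact ((mem_neighborFinset _ _ _).1 (hx ▸ Finset.mem_singleton_self x)).ne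
    · obtain ⟨x, y, hxy, hx⟩ := Finset.card_eq_two.1 h
      exact ⟨x, y, by simp [hx], by simp [hx], hxy.symm, by simp [hx]⟩
  choose x y hx hy hne hxy using exists_ends
  exact ⟨fun b s ↦ bif s then x b else y b, hx, fun b ↦ Bool.rec (hy b) (.inr (hx b)), hne,
    fun h ↦ (hxy _ _ h).elim (fun h ↦ ⟨true, h.symm⟩) fun h ↦ ⟨false, h.symm⟩⟩

namespace IsEndMap

variable {e : Vl → Bool → U}

lemma adj_iff (he : IsEndMap T Vl e) (hbip : T.IsBipartiteWith Vl Vh) {b : Vl} {c : U}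
    (hc : c ∈ Vh) : T.Adj b c ↔ ∃ s, e b s = c := by
  refine ⟨he.exists_eq_of_adj, ?_⟩
  rintro ⟨s, rfl⟩
  exact (he.eq_or_adj b s).resolve_left fun h ↦ Set.disjoint_left.1 hbip.disjoint b.2 (h ▸ hc)

lemma eq_of_notMem (he : IsEndMap T Vl e) (hbip : T.IsBipartiteWith Vl Vh) {b : Vl} {s : Bool}
    (h : e b s ∉ Vh) : e b s = b :=
  (he.eq_or_adj b s).resolve_right fun hadj ↦ h (hbip.mem_of_mem_adj b.2 hadj)

lemma eq_or_eq_of_common (he : IsEndMap T Vl e) (hbip : T.IsBipartiteWith Vl Vh) {b b' : Vl}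
    {s s' : Bool} {u : U} (hu : u ∈ s(b.1, e b s)) (hu' : u ∈ s(b'.1, e b' s')) :
    b = b' ∨ e b s = e b' s' := by
  rw [Sym2.mem_iff] at hu hu'
  by_cases h : u ∈ Vh
  · have hne (b : Vl) : u ≠ b := fun hb ↦ Set.disjoint_left.1 hbip.disjoint b.2 (hb ▸ h)
    exact .inr ((hu.resolve_left (hne b)).symm.trans (hu'.resolve_left (hne b')))
  · have eq_coe {b : Vl} {s : Bool} : u = b ∨ u = e b s → u = b :=
      Or.rec id fun hb ↦ hb.trans (he.eq_of_notMem hbip (hb ▸ h))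
    exact .inl (Subtype.ext ((eq_coe hu).symm.trans (eq_coe hu')))

lemma exists_mem_mem_of_adj (he : IsEndMap T Vl e) (hbip : T.IsBipartiteWith Vl Vh) {u v : U}
    (huv : T.Adj u v) : ∃ b s, u ∈ s(b.1, e b s) ∧ v ∈ s(b.1, e b s) := by
  obtain ⟨hl, -⟩ | ⟨-, hl⟩ := hbip.mem_of_adj huv
  · obtain ⟨s, rfl⟩ := he.exists_eq_of_adj (b := ⟨u, hl⟩) huv
    exact ⟨_, s, Sym2.mem_mk_left _ _, Sym2.mem_mk_right _ _⟩
  · obtain ⟨s, rfl⟩ := he.exists_eq_of_adj (b := ⟨v, hl⟩) huv.symm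
    exact ⟨_, s, Sym2.mem_mk_right _ _, Sym2.mem_mk_left _ _⟩

lemma induction (he : IsEndMap T Vl e) (hbip : T.IsBipartiteWith Vl Vh) (hT : T.Preconnected)
    (P : U → Prop) (step : ∀ b s t, P (e b s) → P (e b t)) {b b' : Vl} {s s' : Bool}
    (h : P (e b s)) : P (e b' s') := by
  have step_common {b b' : Vl} {s s' : Bool} {u : U} (hu : u ∈ s(b.1, e b s))
      (hu' : u ∈ s(b'.1, e b' s')) (h : P (e b s)) : P (e b' s') := by
    obtain rfl | heq := he.eq_or_eq_of_common hbip hu hu'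
    · exact step b s s' h
    · exact heq ▸ h
  have step_walk {u v : U} (walk : T.Walk u v) (hv : v ∈ s(b'.1, e b' s')) :
      ∀ b s, u ∈ s(b.1, e b s) → P (e b s) → P (e b' s') := by
    induction walk with
    | nil => exact fun b s hu ↦ step_common hu hv
    | cons hadj _ ih =>
      intro b s hu h
      obtain ⟨b₀, s₀, hu₀, hv₀⟩ := he.exists_mem_mem_of_adj hbip hadj
      exact ih hv b₀ s₀ hv₀ (step_common hu hu₀ h)
  exact step_walk (hT b b').some (Sym2.mem_mk_left _ _) b s (Sym2.mem_mk_left _ _) h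

lemma reachable_deleteEdges (he : IsEndMap T Vl e) (hbip : T.IsBipartiteWith Vl Vh) {b b' : Vl}
    (h : b' ≠ b) (s : Bool) : (T.deleteEdges {s(b.1, e b true)}).Reachable b' (e b' s) := by
  obtain hs | hs := he.eq_or_adj b' s
  · rw [hs]
  · refine (deleteEdges_adj.2 ⟨hs, fun heq ↦ ?_⟩).reachable
    obtain ⟨hb, -⟩ | ⟨hb, -⟩ := Sym2.eq_iff.1 (mem_singleton_iff.1 heq)
    · exact h (Subtype.ext hb)
    · exact Set.disjoint_left.1 hbip.disjoint b'.2
        (hb ▸ hbip.mem_of_mem_adj b.2 (he.adj_true b))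

lemma not_reachable_deleteEdges (he : IsEndMap T Vl e) (hT : T.IsAcyclic) (b : Vl) :
    ¬ (T.deleteEdges {s(b.1, e b true)}).Reachable (e b true) (e b false) := by
  have hbridge := isBridge_iff.1 (isAcyclic_iff_forall_adj_isBridge.1 hT (he.adj_true b))
  refine fun h ↦ hbridge ?_
  obtain hb | hb := he.eq_or_adj b false
  · exact (hb ▸ h).symm
  · refine (deleteEdges_adj.2 ⟨hb, fun heq ↦ ?_⟩).reachable.trans h.symm
    obtain ⟨-, heq⟩ | ⟨heq, -⟩ := Sym2.eq_iff.1 (mem_singleton_iff.1 heq)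
    · exact he.ne b heq
    · exact (he.adj_true b).ne heq

open Classical in
/-- The auxiliary tree of a low-high tree: its edges are the low vertices, and its vertices are
their ends, that is, the high vertices and one leaf for each low vertex of degree one. -/
noncomputable def edgeTree (he : IsEndMap T Vl e) (hbip : T.IsBipartiteWith Vl Vh)
    (hT : T.IsTree) : EdgeTree Vl (range (Function.uncurry e)) where
  endpoint b s := ⟨e b s, (b, s), rfl⟩
  side b c := decide ((T.deleteEdges {s(b.1, e b true)}).Reachable (e b true) c)
  side_endpoint b
    | true => decide_eq_true .rfl
    | false => decide_eq_false (he.not_reachable_deleteEdges hT.isAcyclic b)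
  side_endpoint_eq {b b'} h s t := by
    have hst := (he.reachable_deleteEdges hbip h s).symm.trans (he.reachable_deleteEdges hbip h t)
    exact decide_eq_decide.2 ⟨fun h ↦ h.trans hst, fun h ↦ h.trans hst.symm⟩
  induction P step := by
    rintro ⟨_, ⟨b, s⟩, rfl⟩ ⟨_, ⟨b', s'⟩, rfl⟩ h
    obtain ⟨_, h⟩ := he.induction hbip hT.1.preconnected (fun u ↦ ∃ hu, P ⟨u, hu⟩)
      (b := b) (b' := b') (s := s) (s' := s')
      (fun b s t ⟨_, h⟩ ↦ ⟨⟨(b, t), rfl⟩, step b s t h⟩) ⟨_, h⟩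
    exact h

variable {he : IsEndMap T Vl e} {hbip : T.IsBipartiteWith Vl Vh} {hT : T.IsTree}

lemma inl_mem_block_edgeTree {b : Vl} {c : range (Function.uncurry e)} :
    .inl c ∈ (he.edgeTree hbip hT).block b ↔ ∃ s, e b s = c := by
  simp [edgeTree, Subtype.ext_iff]

lemma isInternal_edgeTree [Fintype U] [DecidableRel T.Adj] (hhigh : ∀ v ∈ Vh, 2 ≤ T.degree v)
    {c : range (Function.uncurry e)} : (he.edgeTree hbip hT).IsInternal c ↔ c.1 ∈ Vh := by
  simp only [EdgeTree.IsInternal, inl_mem_block_edgeTree]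
  constructor
  · rintro ⟨b, b', hne, ⟨s, hs⟩, s', hs'⟩
    by_contra hc
    have hb := he.eq_of_notMem hbip (hs ▸ hc)
    have hb' := he.eq_of_notMem hbip (hs' ▸ hc)
    exact hne (Subtype.ext (by rw [← hb, hs, ← hs', hb']))
  · intro hc
    obtain ⟨b, hb, b', hb', hne⟩ := Finset.one_lt_card.1 (hhigh _ hc)
    rw [mem_neighborFinset] at hb hb'
    have mem_low {b} (h : T.Adj c b) : b ∈ Vl := hbip.symm.mem_of_mem_adj hc h
    exact ⟨⟨b, mem_low hb⟩, ⟨b', mem_low hb'⟩, fun h ↦ hne (congrArg Subtype.val h),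
      he.exists_eq_of_adj hb.symm, he.exists_eq_of_adj hb'.symm⟩

lemma nonempty_iso_prunedSubdivision [Fintype U] [DecidableRel T.Adj] (hunion : Vl ∪ Vh = univ)
    (hhigh : ∀ v ∈ Vh, 2 ≤ T.degree v) :
    Nonempty (T ≃g (he.edgeTree hbip hT).prunedSubdivision) := by
  have mem_range {c : U} (hc : c ∈ Vh) : c ∈ range (Function.uncurry e) := by
    obtain ⟨b, hb⟩ := (T.degree_pos_iff_exists_adj c).1 (by have := hhigh c hc; omega)
    obtain ⟨s, hs⟩ := he.exists_eq_of_adj (b := ⟨b, hbip.symm.mem_of_mem_adj hc hb⟩) hb.symm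
    exact ⟨(_, s), hs⟩
  obtain ⟨f⟩ := nonempty_iso_bipartiteGraphOfRel hbip hunion
  let g : Vh ≃ {c // (he.edgeTree hbip hT).IsInternal c} :=
    (Equiv.subtypeSubtypeEquivSubtype mem_range).symm.trans
      (Equiv.subtypeEquivRight fun _ ↦ (isInternal_edgeTree hhigh).symm)
  exact ⟨f.symm.trans (bipartiteGraphOfRelIso (Equiv.refl _) g fun b c ↦
    inl_mem_block_edgeTree.trans (he.adj_iff hbip c.2).symm)⟩

end IsEndMap

lemma card_le_card_edgeFinset_of_iso_prunedSubdivision {L C : Type*} [Finite L] {A : EdgeTree L C}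
    [Finite U] [Fintype T.edgeSet] (hT : T.IsTree) (f : T ≃g A.prunedSubdivision) {c : C}
    (hc : A.IsInternal c) : Nat.card L ≤ T.edgeFinset.card := by
  have := Fintype.ofFinite U
  have : Finite (L ⊕ {c // A.IsInternal c}) := .of_equiv _ f.toEquiv
  have : Finite {c // A.IsInternal c} := .of_injective (Sum.inr (α := L)) Sum.inr_injective
  have hcard := Nat.card_congr f.toEquiv
  rw [Nat.card_sum, Nat.card_eq_fintype_card, ← hT.card_edgeFinset] at hcard
  have : 0 < Nat.card {c // A.IsInternal c} := Nat.card_pos_iff.2 ⟨⟨c, hc⟩, inferInstance⟩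
  omega

lemma exists_edgeTree_of_isLowHighTree [Fintype U] [Nontrivial U] [DecidableRel T.Adj]
    (hT : T.IsLowHighTree) :
    ∃ (L C : Set U) (A : EdgeTree L C), Nonempty (T ≃g A.prunedSubdivision) := by
  obtain ⟨htree, Vl, Vh, hunion, hbip, hlow, hhigh⟩ := hT
  obtain ⟨e, he⟩ := exists_isEndMap
    (fun v _ ↦ htree.1.preconnected.degree_pos_of_nontrivial v) hlow
  exact ⟨Vl, _, he.edgeTree hbip htree, he.nonempty_iso_prunedSubdivision hunion hhigh⟩

end LowHigh

open SimpleGraph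

theorem mainTheorem5 {U : Type*} [Fintype U] [Nontrivial U] (T : SimpleGraph U)
    [DecidableRel T.Adj] (hT : T.IsLowHighTree) :
    ∃ (d : ℕ) (V : Type) (_ : Fintype V) (G : SimpleGraph V) (_ : DecidableRel G.Adj),
      G.IsRegularOfDegree d ∧
      T.IsBlockDecompositionTreeOf G ∧
      8 ≤ d ∧ d ≤ 4 * T.edgeFinset.card ∧
      G.IsMinimalForbiddenMinor (SimpleGraph.MinorMinDegreeLE (d - 1)) := by
  classical
  let f : T ≃g T.map (Fintype.equivFin U).toEmbedding := Iso.map (Fintype.equivFin U) T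
  have : Nontrivial (Fin (Fintype.card U)) := (Fintype.equivFin U).symm.nontrivial
  obtain ⟨L, C, A, ⟨g⟩⟩ := exists_edgeTree_of_isLowHighTree (isLowHighTree_of_iso f hT)
  obtain ⟨u⟩ := hT.1.1.nonempty
  obtain ⟨v, huv⟩ := hT.1.1.preconnected.exists_adj_of_nontrivial u
  obtain ⟨c, hc⟩ := EdgeTree.exists_isInternal_of_adj ((f.trans g).map_rel_iff.2 huv)
  have : Nontrivial L := let ⟨b, b', hne, _⟩ := hc; ⟨b, b', hne⟩
  have hL : 1 < Nat.card L := Finite.one_lt_card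
  obtain ⟨h⟩ := A.nonempty_prunedSubdivision_iso_blockGraph
  refine ⟨4 * Nat.card L, EdgeTree.Vertex L C, inferInstance, A.graph, inferInstance, fun x ↦ ?_,
    ⟨EdgeTree.graph_connected, ⟨(f.trans g).trans h⟩⟩, by omega, ?_, ?_⟩
  · rw [← card_neighborSet_eq_degree, ← Nat.card_eq_fintype_card, Nat.card_coe_set_eq,
      A.ncard_neighborSet]
  · grw [card_le_card_edgeFinset_of_iso_prunedSubdivision hT.1 (f.trans g) hc]
  · exact isMinimalForbiddenMinor_of_regular (by omega) A.ncard_neighborSet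
      fun _ _ _ _ hK hdeg ↦ EdgeTree.card_le_card_of_isMinor hK hdeg
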